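/- For $k\ge 0$ let $C(k)=\frac{1}{k+1}\binom{2k}{k}$ be the $k$-th Catalan number, and let $\binom{a+b+c}{a,\,b,\,c}=\frac{(a+b+c)!}{a!\,b!\,c!}$ denote the multinomial coefficient. Let $n,m$ be positive integers, not both equal to $1$, such that $n\equiv m \pmod 2$. Then \[ \sum_{d=0}^{\min(n,m)}(-1)^{d+1}\,2^{2d-1}\,\frac{n+m-2d}{n+m-d}\cdot\frac{n+m-2d-1}{n+m-d-1}\binom{n+m-d}{n-d,\;m-d,\;d}\,C\!\left(\frac{n+m}{2}-d-1\right) =\begin{cases} C\!\left(\frac n2-1\right)C\!\left(\frac m2-1\right) & \text{if } n \text{ and } m \text{ are even},\\[2pt] 0 & \text{if } n \text{ and } m \text{ are odd.}\end{cases} \] (If $n=m$, the term $d=n$ is understood to be $0$, because of the factor $n+m-2d$, although the Catalan number in it would have index $-1$.) -/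

import Mathlib

/-! With `n + m = 2k`, the sum is up to its `d = 0` term the terminating ₃F₂(-n, -m, 1-k; (1-n-m)/2,
2-2k; 1), a case of Watson's summation. For fixed `k`, telescoping (`watsonSum_shift`) links the
sums at `(n+2, m)` and `(n, m+2)`. Moving by 2 reduces even pairs to `n = 0`, where one term
survives, and odd pairs to `n = 1`, where two terms cancel. `summand_eq` identifies the stated
summand with the hypergeometric one. -/

/-- The reciprocal of `(n - d)!`, taken to be `0` for `n < d`. -/
def invFact (n d : ℕ) : ℚ := (n.descFactorial d : ℚ) / (n.factorial : ℚ)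

theorem invFact_succ_right (n d : ℕ) : invFact n (d + 1) = ((n : ℚ) - d) * invFact n d := by
  unfold invFact
  rcases le_or_gt d n with h | h
  · rw [Nat.descFactorial_succ]
    push_cast [Nat.cast_sub h]
    ring
  · rw [Nat.descFactorial_eq_zero_iff_lt.2 h, Nat.descFactorial_eq_zero_iff_lt.2 (by omega)]
    simp

/-- Holds for every `d`: at `d = n + 1` the linear factor vanishes, beyond that both reciprocals do.
-/
theorem invFact_eq_mul_succ_left (n d : ℕ) :
    invFact n d = ((n : ℚ) + 1 - d) * invFact (n + 1) d := by
  unfold invFact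
  have hn : (n.factorial : ℚ) ≠ 0 := by positivity
  rcases le_or_gt d (n + 1) with h | h
  · have h1 : ((n + 1 - d : ℕ) : ℚ) * (n + 1).descFactorial d = (n + 1) * n.descFactorial d := by
      exact_mod_cast Nat.succ_descFactorial n d
    push_cast [Nat.cast_sub h] at h1
    rw [Nat.factorial_succ]
    push_cast
    field_simp
    linarith
  · rw [Nat.descFactorial_eq_zero_iff_lt.2 h, Nat.descFactorial_eq_zero_iff_lt.2 (by omega)]
    simp

theorem invFact_of_le {n d : ℕ} (h : d ≤ n) : invFact n d = 1 / ((n - d).factorial : ℚ) := by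
  unfold invFact
  have h1 : ((n - d).factorial : ℚ) * n.descFactorial d = n.factorial := by
    exact_mod_cast Nat.factorial_mul_descFactorial h
  rw [← h1]
  have h2 : ((n - d).factorial : ℚ) ≠ 0 := by positivity
  have h3 : (n.descFactorial d : ℚ) ≠ 0 := by
    rw [Nat.cast_ne_zero, Ne, Nat.descFactorial_eq_zero_iff_lt]
    omega
  field_simp

theorem invFact_of_lt {n d : ℕ} (h : n < d) : invFact n d = 0 := by
  simp [invFact, Nat.descFactorial_eq_zero_iff_lt.2 h]

/-- The part of the summand that depends on `n` and `m` only through `k = (n + m) / 2`. -/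
def weight (k d : ℕ) : ℚ :=
  (-1) ^ (d + 1) * (4 ^ d / 2) * ((2 * k - d - 2).factorial / d.factorial) *
    (((k - d : ℕ) : ℚ) * (k - d).centralBinom)

theorem weight_self (k : ℕ) : weight k k = 0 := by simp [weight]

theorem weight_succ {k d : ℕ} (h : d < k) :
    ((2 : ℚ) * k - 2 - d) * (2 * k - 2 * d - 1) * (d + 1) * weight k (d + 1) =
      -2 * (k - 1 - d) * weight k d := by
  obtain ⟨e, rfl⟩ := Nat.exists_eq_add_of_lt h
  -- At `d = k - 1` both sides vanish; treating this apart avoids the truncated factorial at `k =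
  -- 1`.
  rcases Nat.eq_zero_or_pos e with rfl | he
  · rw [show d + 0 + 1 = d + 1 by rfl, weight_self]
    push_cast
    ring
  have hf : (2 * (d + e + 1) - d - 2).factorial =
      (d + 2 * e) * (2 * (d + e + 1) - (d + 1) - 2).factorial := by
    rw [show 2 * (d + e + 1) - d - 2 = (2 * (d + e + 1) - (d + 1) - 2) + 1 by omega,
      Nat.factorial_succ]
    congr 1
    omega
  have hc : ((e : ℚ) + 1) * (e + 1).centralBinom = 2 * (2 * e + 1) * e.centralBinom := by
    exact_mod_cast Nat.succ_mul_centralBinom_succ e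
  unfold weight
  rw [hf, show d + e + 1 - (d + 1) = e by omega, show d + e + 1 - d = e + 1 by omega,
    Nat.factorial_succ d]
  push_cast
  rw [hc]
  have hd : (d.factorial : ℚ) ≠ 0 := by positivity
  field_simp
  ring

/-! ### Watson's summation by a contiguous relation -/

/-- The sum of the statement, in terms of `invFact` and `weight`. -/
def watsonSum (k n m : ℕ) : ℚ :=
  ∑ d ∈ Finset.range k, invFact n d * invFact m d * weight k d

theorem watsonSum_comm (k n m : ℕ) : watsonSum k n m = watsonSum k m n := by
  unfold watsonSum
  exact Finset.sum_congr rfl fun d _ => by ring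

theorem watsonSum_shift {k n m : ℕ} (h : n + m + 2 = 2 * k) :
    ((n : ℚ) + 2) * (m - 1) * watsonSum k (n + 2) m =
      (n - 1) * (m + 2) * watsonSum k n (m + 2) := by
  have hk : (2 : ℚ) * k = n + m + 2 := by exact_mod_cast h.symm
  -- Telescoping certificate: it vanishes at `0` through the factor `d`, and at `k` through `weight
  -- k k = 0`.
  let G : ℕ → ℚ := fun d => -((m : ℚ) - n) * d * (2 * k - 1 - d) * (2 * k - 2 * d + 1) *
    (invFact (n + 2) d * invFact (m + 2) d * weight k d)
  have hG : ∀ d ∈ Finset.range k,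
      ((n : ℚ) + 2) * (m - 1) * (invFact (n + 2) d * invFact m d * weight k d) -
        (n - 1) * (m + 2) * (invFact n d * invFact (m + 2) d * weight k d) = G (d + 1) - G d := by
    intro d hd
    have hw := weight_succ (Finset.mem_range.1 hd)
    simp only [G]
    -- Everything becomes a polynomial times `invFact (n + 2) d * invFact (m + 2) d`, times a weight
    -- at `d` or `d + 1`.
    rw [invFact_eq_mul_succ_left n, invFact_eq_mul_succ_left m, invFact_eq_mul_succ_left (n + 1),
      invFact_eq_mul_succ_left (m + 1), invFact_succ_right, invFact_succ_right]
    push_cast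
    have hk' : (k : ℚ) = (n + m + 2) / 2 := by linarith
    rw [hk'] at hw ⊢
    linear_combination ((m : ℚ) - n) * (n + 2 - d) * (m + 2 - d) * invFact (n + 2) d *
      invFact (m + 2) d * hw
  have hs := Finset.sum_congr rfl hG
  rw [Finset.sum_range_sub, Finset.sum_sub_distrib, ← Finset.mul_sum, ← Finset.mul_sum] at hs
  have h0 : G 0 = 0 := by simp [G]
  have h1 : G k = 0 := by simp [G, weight_self]
  rw [h0, h1] at hs
  unfold watsonSum
  linarith

theorem watsonSum_zero_left {k : ℕ} (hk : 0 < k) :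
    watsonSum k 0 (2 * k) = -(k.centralBinom : ℚ) / (4 * (2 * k - 1)) := by
  obtain ⟨e, rfl⟩ := Nat.exists_eq_add_of_lt hk
  unfold watsonSum
  rw [Finset.sum_eq_single_of_mem 0 (by simp)
    fun d _ hd => by rw [invFact_of_lt (Nat.pos_of_ne_zero hd)]; ring]
  rw [invFact_of_le le_rfl, invFact_of_le (Nat.zero_le _)]
  have h1 : (2 * (0 + e + 1) - 0).factorial = (2 * e + 2) * ((2 * e + 1) * (2 * e).factorial) := by
    rw [show 2 * (0 + e + 1) - 0 = 2 * e + 1 + 1 by omega, Nat.factorial_succ, Nat.factorial_succ]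
  have h2 : 2 * (0 + e + 1) - 0 - 2 = 2 * e := by omega
  unfold weight
  rw [h1, h2]
  simp only [zero_add, Nat.sub_zero]
  push_cast
  have hf : ((2 * e).factorial : ℚ) ≠ 0 := by positivity
  have h3 : (2 * ((e : ℚ) + 1) - 1) ≠ 0 := by
    have : (0 : ℚ) < 2 * ((e : ℚ) + 1) - 1 := by
      have : (0 : ℚ) ≤ e := by positivity
      linarith
    exact this.ne'
  simp
  field_simp
  ring

theorem watsonSum_one_left {k : ℕ} (hk : 2 ≤ k) : watsonSum k 1 (2 * k - 1) = 0 := by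
  obtain ⟨e, rfl⟩ := Nat.exists_eq_add_of_le' hk
  unfold watsonSum
  rw [← Finset.sum_subset (Finset.range_mono hk)
    fun d _ hd => by rw [invFact_of_lt (by simpa using hd)]; ring]
  rw [Finset.sum_range_succ, Finset.sum_range_one]
  have hw := weight_succ (k := e + 2) (d := 0) (by omega)
  rw [invFact_succ_right, invFact_succ_right,
    show 2 * (e + 2) - 1 = 2 * e + 3 by omega]
  push_cast at hw ⊢
  have he : (0 : ℚ) < 2 * (e + 1) := by positivity
  have hw' : (2 * (e : ℚ) + 3) * weight (e + 2) (0 + 1) = - weight (e + 2) 0 := by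
    apply mul_left_cancel₀ he.ne'
    linear_combination hw
  linear_combination (invFact 1 0 * invFact (2 * e + 3) 0) * hw'

/-- The factor in `i` is C(i-1), continued to C(-1) = -1/2, so that the induction can start at `i =
0`. Quantifying over `j` keeps `i + j` fixed in the inductive step. -/
theorem watsonSum_even (i : ℕ) : ∀ j : ℕ, i ≤ j → 0 < j →
    watsonSum (i + j) (2 * i) (2 * j) =
      (i.centralBinom : ℚ) / (2 * (2 * i - 1)) * (j.centralBinom / (2 * (2 * j - 1))) := by
  induction i with
  | zero =>
    intro j _ hj
    rw [zero_add, mul_zero, watsonSum_zero_left hj]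
    have : (2 * (j : ℚ) - 1) ≠ 0 := by
      have : (1 : ℚ) ≤ j := by exact_mod_cast hj
      linarith
    simp
    field_simp
    norm_num
  | succ i ih =>
    intro j hij hj
    have hs := watsonSum_shift (k := i + 1 + j) (n := 2 * i) (m := 2 * j) (by ring)
    have h1 := ih (j + 1) (by omega) (by omega)
    rw [show i + (j + 1) = i + 1 + j by ring, show 2 * (j + 1) = 2 * j + 2 by ring] at h1
    rw [h1] at hs
    have hci : ((i : ℚ) + 1) * (i + 1).centralBinom = 2 * (2 * i + 1) * i.centralBinom := by
      exact_mod_cast Nat.succ_mul_centralBinom_succ i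
    have hcj : ((j : ℚ) + 1) * (j + 1).centralBinom = 2 * (2 * j + 1) * j.centralBinom := by
      exact_mod_cast Nat.succ_mul_centralBinom_succ j
    have hi0 : (2 * (i : ℚ) - 1) ≠ 0 := by
      intro h
      have : (2 * i : ℤ) = 1 := by exact_mod_cast (by linarith : 2 * (i : ℚ) = 1)
      omega
    have hj0 : (2 * (j : ℚ) - 1) ≠ 0 := by
      have : (1 : ℚ) ≤ j := by exact_mod_cast hj
      linarith
    have hi1 : (i : ℚ) + 1 ≠ 0 := by positivity
    have hj1 : (j : ℚ) + 1 ≠ 0 := by positivity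
    have hi2 : 2 * (i : ℚ) + 1 ≠ 0 := by positivity
    have hj2 : 2 * (j : ℚ) + 1 ≠ 0 := by positivity
    rw [eq_div_of_mul_eq hi1 ((mul_comm _ _).trans hci)]
    rw [eq_div_of_mul_eq hj1 ((mul_comm _ _).trans hcj)] at hs
    rw [show 2 * (i + 1) = 2 * i + 2 by ring]
    push_cast at hs ⊢
    have hc : (2 * (i : ℚ) + 2) * (2 * j - 1) ≠ 0 :=
      mul_ne_zero (by positivity) hj0
    apply mul_left_cancel₀ hc
    rw [hs]
    rw [show 2 * ((i : ℚ) + 1) - 1 = 2 * i + 1 by ring,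
      show 2 * ((j : ℚ) + 1) - 1 = 2 * j + 1 by ring]
    field_simp

theorem watsonSum_odd (i : ℕ) : ∀ j : ℕ, i ≤ j → 0 < j →
    watsonSum (i + j + 1) (2 * i + 1) (2 * j + 1) = 0 := by
  induction i with
  | zero =>
    intro j _ hj
    have := watsonSum_one_left (k := j + 1) (by omega)
    simpa [show 2 * (j + 1) - 1 = 2 * j + 1 by omega] using this
  | succ i ih =>
    intro j hij hj
    have hs := watsonSum_shift (k := i + 1 + j + 1) (n := 2 * i + 1) (m := 2 * j + 1) (by ring)
    have h1 := ih (j + 1) (by omega) (by omega)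
    rw [show i + (j + 1) + 1 = i + 1 + j + 1 by ring,
      show 2 * (j + 1) + 1 = 2 * j + 1 + 2 by ring] at h1
    rw [h1, mul_zero] at hs
    -- The coefficient `m - 1` is `2 * j`, nonzero because `0 < j`.
    refine (mul_eq_zero.1 hs).resolve_left (mul_ne_zero (by positivity) ?_)
    have : (1 : ℚ) ≤ j := by exact_mod_cast hj
    push_cast
    linarith

/-! ### Translation of the stated sum -/

theorem catalan_cast_eq_centralBinom_succ (i : ℕ) :
    (catalan i : ℚ) = (i + 1).centralBinom / (2 * (2 * ((i + 1 : ℕ) : ℚ) - 1)) := by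
  have h1 : ((i : ℚ) + 1) * catalan i = i.centralBinom := by
    exact_mod_cast succ_mul_catalan_eq_centralBinom i
  have h2 : ((i : ℚ) + 1) * (i + 1).centralBinom = 2 * (2 * i + 1) * i.centralBinom := by
    exact_mod_cast Nat.succ_mul_centralBinom_succ i
  have h3 : (i : ℚ) + 1 ≠ 0 := by positivity
  have h4 : 2 * (i : ℚ) + 1 ≠ 0 := by positivity
  rw [eq_div_of_mul_eq h3 ((mul_comm _ _).trans h2), ← h1]
  push_cast
  rw [show 2 * ((i : ℚ) + 1) - 1 = 2 * i + 1 by ring]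
  field_simp

theorem summand_eq {n m k d : ℕ} (hk : n + m = 2 * k) (hk2 : 2 ≤ k) (hdn : d ≤ n) (hdm : d ≤ m) :
    (-1 : ℚ) ^ (d + 1) * (2 : ℚ) ^ (2 * (d : ℤ) - 1) *
        (((n : ℚ) + m - 2 * d) / ((n : ℚ) + m - d)) *
        (((n : ℚ) + m - 2 * d - 1) / ((n : ℚ) + m - d - 1)) *
        (Nat.multinomial Finset.univ ![n - d, m - d, d] : ℚ) *
        (catalan ((n + m) / 2 - d - 1) : ℚ) =
      invFact n d * invFact m d * weight k d := by
  have hq : (n : ℚ) + m = 2 * k := by exact_mod_cast hk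
  rw [hq]
  rcases (show d ≤ k by omega).eq_or_lt with rfl | hd
  -- Here `n = m = d`: the factor `n + m - 2d` is zero, whatever the truncated Catalan index gives.
  · simp [weight_self]
  obtain ⟨e, rfl⟩ := Nat.exists_eq_add_of_lt hd
  have hmult : (Nat.multinomial Finset.univ ![n - d, m - d, d] : ℚ) =
      (d + 2 * e + 2) * (d + 2 * e + 1) * (d + 2 * e).factorial *
        (1 / ((n - d).factorial : ℚ)) * (1 / ((m - d).factorial : ℚ)) / d.factorial := by
    have h := Nat.multinomial_spec Finset.univ ![n - d, m - d, d]
    simp only [Fin.prod_univ_three, Fin.sum_univ_three, Matrix.cons_val_zero,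
      Matrix.cons_val_one, Matrix.cons_val] at h
    rw [show n - d + (m - d) + d = d + 2 * e + 1 + 1 by omega, Nat.factorial_succ,
      Nat.factorial_succ] at h
    have h' := congrArg (Nat.cast : ℕ → ℚ) h
    push_cast at h'
    have h1 : ((n - d).factorial : ℚ) ≠ 0 := by positivity
    have h2 : ((m - d).factorial : ℚ) ≠ 0 := by positivity
    have h3 : (d.factorial : ℚ) ≠ 0 := by positivity
    field_simp
    linear_combination h'
  have hpow : (2 : ℚ) ^ (2 * (d : ℤ) - 1) = 4 ^ d / 2 := by
    rw [zpow_sub₀ two_ne_zero, zpow_mul, zpow_natCast]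
    norm_num
  rw [hmult, hpow, show (n + m) / 2 - d - 1 = e by omega, catalan_cast_eq_centralBinom_succ,
    invFact_of_le hdn, invFact_of_le hdm]
  unfold weight
  rw [show 2 * (d + e + 1) - d - 2 = d + 2 * e by omega, show d + e + 1 - d = e + 1 by omega]
  have hpos : (0 : ℚ) < d + 2 * e := by exact_mod_cast (by omega : 0 < d + 2 * e)
  have h1 : (d : ℚ) + 2 * e + 2 ≠ 0 := by positivity
  have h2 : (d : ℚ) + 2 * e + 1 ≠ 0 := by positivity
  have h3 : 2 * (e : ℚ) + 1 ≠ 0 := by positivity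
  push_cast
  rw [show 2 * ((d : ℚ) + e + 1) - 2 * d - 1 = 2 * e + 1 by ring,
    show 2 * ((d : ℚ) + e + 1) - d - 1 = d + 2 * e + 1 by ring,
    show 2 * ((d : ℚ) + e + 1) - d = d + 2 * e + 2 by ring,
    show 2 * ((d : ℚ) + e + 1) - 2 * d = 2 * (e + 1) by ring,
    show 2 * ((e : ℚ) + 1) - 1 = 2 * e + 1 by ring]
  field_simp

theorem sum_eq_watsonSum {n m k : ℕ} (hk : n + m = 2 * k) (hk2 : 2 ≤ k) :
    ∑ d ∈ Finset.range (min n m + 1),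
      (-1 : ℚ) ^ (d + 1) * (2 : ℚ) ^ (2 * (d : ℤ) - 1) *
        (((n : ℚ) + m - 2 * d) / ((n : ℚ) + m - d)) *
        (((n : ℚ) + m - 2 * d - 1) / ((n : ℚ) + m - d - 1)) *
        (Nat.multinomial Finset.univ ![n - d, m - d, d] : ℚ) *
        (catalan ((n + m) / 2 - d - 1) : ℚ) = watsonSum k n m := by
  have h1 : watsonSum k n m =
      ∑ d ∈ Finset.range (k + 1), invFact n d * invFact m d * weight k d := by
    rw [Finset.sum_range_succ, weight_self, mul_zero, add_zero, watsonSum]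
  -- Terms with `min n m < d` vanish through `invFact`.
  rw [h1, ← Finset.sum_subset (Finset.range_mono (show min n m + 1 ≤ k + 1 by omega))]
  · refine Finset.sum_congr rfl fun d hd => ?_
    rw [Finset.mem_range] at hd
    exact summand_eq hk hk2 (by omega) (by omega)
  · intro d _ hd
    rw [Finset.mem_range, not_lt, Nat.succ_le_iff, min_lt_iff] at hd
    rcases hd with h | h <;> simp [invFact_of_lt h]

theorem watsonSum_even_catalan (i j : ℕ) :
    watsonSum (i + 1 + (j + 1)) (2 * (i + 1)) (2 * (j + 1)) = (catalan i : ℚ) * catalan j := by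
  rw [catalan_cast_eq_centralBinom_succ, catalan_cast_eq_centralBinom_succ]
  rcases le_total (i + 1) (j + 1) with h | h
  · exact watsonSum_even _ _ h (Nat.succ_pos j)
  · rw [watsonSum_comm, add_comm (i + 1), watsonSum_even _ _ h (Nat.succ_pos i), mul_comm]

theorem watsonSum_odd_eq_zero {i j : ℕ} (h : ¬ (i = 0 ∧ j = 0)) :
    watsonSum (i + j + 1) (2 * i + 1) (2 * j + 1) = 0 := by
  rcases le_total i j with hij | hij
  · exact watsonSum_odd _ _ hij (by omega)
  · rw [watsonSum_comm, add_comm i j]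
    exact watsonSum_odd _ _ hij (by omega)

theorem corollaryC (n m : ℕ) (hn : 0 < n) (hm : 0 < m) (hne : ¬ (n = 1 ∧ m = 1))
    (hmod : n ≡ m [MOD 2]) :
    ∑ d ∈ Finset.range (min n m + 1),
      (-1 : ℚ) ^ (d + 1) * (2 : ℚ) ^ (2 * (d : ℤ) - 1) *
        (((n : ℚ) + m - 2 * d) / ((n : ℚ) + m - d)) *
        (((n : ℚ) + m - 2 * d - 1) / ((n : ℚ) + m - d - 1)) *
        (Nat.multinomial Finset.univ ![n - d, m - d, d] : ℚ) *
        (catalan ((n + m) / 2 - d - 1) : ℚ) =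
      if Even n ∧ Even m then (catalan (n / 2 - 1) : ℚ) * (catalan (m / 2 - 1) : ℚ) else 0 := by
  unfold Nat.ModEq at hmod
  rw [sum_eq_watsonSum (k := (n + m) / 2) (by omega) (by omega)]
  rcases Nat.even_or_odd n with he | ho
  · have he' : Even m := by rw [Nat.even_iff] at he ⊢; omega
    rw [if_pos ⟨he, he'⟩]
    rw [Nat.even_iff] at he he'
    rw [← watsonSum_even_catalan]
    congr 1 <;> omega
  · rw [if_neg fun h => (Nat.not_even_iff_odd.2 ho) h.1]
    rw [Nat.odd_iff] at ho
    rw [← watsonSum_odd_eq_zero (i := n / 2) (j := m / 2) (by omega)]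
    congr 1 <;> omega
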